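/- Let $G$ be a finite simple graph. An interval $t$-coloring of $G$ ($t$ a positive integer) is a proper edge-coloring of $G$ with colors $1,\dots,t$ in which all $t$ colors are used and, for every vertex $v$, the colors of the edges incident to $v$ form an interval of integers. $G$ is interval colorable if it has an interval $t$-coloring for some positive integer $t$; in that case $w(G)$ denotes the least such $t$. $G$ is outerplanar if it can be embedded in the plane so that all its vertices lie on the boundary of the unbounded face. Theorem. If $G$ is a $2$-connected outerplanar graph with maximum degree $\Delta(G)=3$, then $G$ is interval colorable and $$w(G)=\begin{cases}3,&\text{if }|V(G)|\text{ is even},\\ 4,&\text{if }|V(G)|\text{ is odd}.\end{cases}$$ -/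

import Mathlib

namespace SimpleGraph

/-- A graph is `k`-connected if it has more than `k` vertices and remains connected after the
removal of any fewer than `k` vertices. -/
def IsKConnected {V : Type*} [Fintype V] (G : SimpleGraph V) (k : ℕ) : Prop :=
  k < Fintype.card V ∧
    ∀ S : Finset V, S.card < k → (G.induce {v : V | v ∉ S}).Connected

/-- An embedding of a graph in the Euclidean plane: vertices are distinct points, every edge is
a simple (continuous) arc joining its ends, an arc contains no vertices other than its ends, and
two different arcs meet only in a common end. -/
structure PlaneEmbedding {V : Type*} (G : SimpleGraph V) where
  /-- the point representing a vertex -/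
  point : V → EuclideanSpace ℝ (Fin 2)
  /-- the set of points of the arc representing an edge -/
  arc : G.edgeSet → Set (EuclideanSpace ℝ (Fin 2))
  point_injective : Function.Injective point
  isArc : ∀ (u v : V) (h : G.Adj u v), ∃ γ : _root_.Path (point u) (point v),
    Function.Injective γ ∧ Set.range γ = arc ⟨s(u, v), h⟩
  mem_of_point_mem_arc : ∀ (e : G.edgeSet) (w : V), point w ∈ arc e → w ∈ (e : Sym2 V)
  arc_inter : ∀ e f : G.edgeSet, e ≠ f → ∀ x, x ∈ arc e → x ∈ arc f →
    ∃ w : V, w ∈ (e : Sym2 V) ∧ w ∈ (f : Sym2 V) ∧ x = point w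

/-- The set of all points of the plane used by an embedding. -/
def PlaneEmbedding.carrier {V : Type*} {G : SimpleGraph V} (D : G.PlaneEmbedding) :
    Set (EuclideanSpace ℝ (Fin 2)) :=
  Set.range D.point ∪ ⋃ e : G.edgeSet, D.arc e

/-- The faces of an embedding: the connected components of the complement of its carrier. -/
def PlaneEmbedding.IsFace {V : Type*} {G : SimpleGraph V} (D : G.PlaneEmbedding)
    (F : Set (EuclideanSpace ℝ (Fin 2))) : Prop :=
  ∃ x ∈ D.carrierᶜ, F = connectedComponentIn D.carrierᶜ x

/-- A graph is outerplanar if it can be embedded in the plane so that all its vertices lie on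
(the boundary of) the unbounded face. -/
def IsOuterplanar {V : Type*} (G : SimpleGraph V) : Prop :=
  ∃ (D : G.PlaneEmbedding) (F : Set (EuclideanSpace ℝ (Fin 2))),
    D.IsFace F ∧ ¬ Bornology.IsBounded F ∧ ∀ v : V, D.point v ∈ frontier F

/-- The set `S(v, α)` of colors of the edges incident to `v`. -/
def colorsAt {V : Type*} {G : SimpleGraph V} (α : G.edgeSet → ℕ) (v : V) : Set ℕ :=
  {c | ∃ e : G.edgeSet, v ∈ (e : Sym2 V) ∧ α e = c}

/-- `α` is an interval `t`-coloring: the set of colors used is exactly `{1, …, t}`, edges sharing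
an end have different colors, and the colors at every vertex form an interval of integers. -/
structure IsIntervalColoring {V : Type*} (G : SimpleGraph V) (t : ℕ) (α : G.edgeSet → ℕ) :
    Prop where
  range_eq : Set.range α = Set.Icc 1 t
  proper : ∀ e f : G.edgeSet, e ≠ f → ∀ v : V, v ∈ (e : Sym2 V) → v ∈ (f : Sym2 V) → α e ≠ α f
  interval : ∀ v : V, (colorsAt α v).OrdConnected

/-- The positive integers `t` for which `G` has an interval `t`-coloring. -/
def intervalColorNumbers {V : Type*} (G : SimpleGraph V) : Set ℕ :=
  {t | 0 < t ∧ ∃ α : G.edgeSet → ℕ, G.IsIntervalColoring t α}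

/-- A graph is interval colorable if it has an interval `t`-coloring for some positive `t`. -/
def IsIntervalColorable {V : Type*} (G : SimpleGraph V) : Prop :=
  G.intervalColorNumbers.Nonempty

end SimpleGraph

/-! Everything rests on a Hamiltonian cycle with non-crossing chords. An outerplanar graph has no
`K₂,₃` minor: joining the three vertices on one side to a point of the outer face would draw `K₃,₃`
in the plane, and such a drawing is excluded by counting winding numbers modulo 2. In a 2-connected
graph, an ear on a cycle either can be absorbed into a longer cycle or produces a `K₂,₃` minor. So
there is a Hamiltonian cycle, and two crossing chords of it would again give such a minor once there
are five vertices.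

Since the maximum degree is 3, chords exist and no two share an end. At least three colors are
needed at a vertex of degree 3. In an interval 3-coloring color 2 occurs at every vertex, so its
edges form a perfect matching and the order is even. For even order, alternate 1, 2 on the cycle and
give all chords 3.

For odd order the colors of consecutive cycle edges cannot always differ by 1. The one exception is
put at an end of a chord that cuts off a shortest odd arc, where the cycle edges get 2 and 4 and the
chord 3 (`exists_isIntervalColoring_four`). -/

/-! ### Continuous logarithms and the non-planarity of `K₃,₃`. -/

section ContinuousLogarithm

open Complex

theorem Continuous.exists_exp_eq {X : Type*} [TopologicalSpace X] [SimplyConnectedSpace X]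
    [LocallyPathConnectedSpace X] {g : X → ℂ} (hg : Continuous g) (h0 : ∀ x, g x ≠ 0) :
    ∃ f : X → ℂ, Continuous f ∧ ∀ x, exp (f x) = g x := by
  obtain ⟨x₀⟩ : Nonempty X := inferInstance
  obtain ⟨f, ⟨-, hf⟩, -⟩ := isCoveringMapOn_exp.existsUnique_continuousMap_lifts ⟨g, hg⟩
    (a₀ := x₀) (exp_log (h0 x₀)) h0
  exact ⟨f, f.continuous, fun x ↦ congrFun hf x⟩

theorem Complex.sub_eq_sub_of_exp_eq {f f' : ℝ → ℂ} (hf : Continuous f) (hf' : Continuous f')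
    (h : ∀ t, exp (f t) = exp (f' t)) (a b : ℝ) : f b - f a = f' b - f' a := by
  obtain ⟨F, -, hF⟩ := isCoveringMapOn_exp.existsUnique_continuousMap_lifts
    ⟨fun t ↦ exp (f t), by fun_prop⟩ (a₀ := a) (e₀ := f a) rfl (fun t ↦ exp_ne_zero _)
  have h1 := hF ⟨f, hf⟩ ⟨rfl, rfl⟩
  have h2 := hF ⟨fun t ↦ f' t + (f a - f' a), by fun_prop⟩ ⟨by simp, by
    ext t
    simp [exp_add, exp_sub, h, exp_ne_zero]⟩
  have := congrArg (fun G : C(ℝ, ℂ) ↦ G b) (h1.trans h2.symm)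
  simp only [ContinuousMap.coe_mk] at this
  rw [this]
  ring

/-- The increment over `[0, 1]` of a continuous logarithm of `g`, if there is one. -/
noncomputable def logIncrement (g : ℝ → ℂ) : ℂ :=
  open Classical in
  if h : ∃ f : ℝ → ℂ, Continuous f ∧ ∀ t, exp (f t) = g t then h.choose 1 - h.choose 0 else 0

theorem logIncrement_eq {f g : ℝ → ℂ} (hf : Continuous f) (h : ∀ t, exp (f t) = g t) :
    logIncrement g = f 1 - f 0 := by
  have hex : ∃ f : ℝ → ℂ, Continuous f ∧ ∀ t, exp (f t) = g t := ⟨f, hf, h⟩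
  rw [logIncrement, dif_pos hex]
  exact sub_eq_sub_of_exp_eq hex.choose_spec.1 hf
    (fun t ↦ (hex.choose_spec.2 t).trans (h t).symm) 0 1

theorem exp_logIncrement {g : ℝ → ℂ} (hg : Continuous g) (h0 : ∀ t, g t ≠ 0) :
    exp (logIncrement g) = g 1 / g 0 := by
  obtain ⟨f, hf, h⟩ := hg.exists_exp_eq h0
  rw [logIncrement_eq hf h, exp_sub, h, h]

/-- `γ s - δ t` has a continuous logarithm on the plane of parameters, so its increments along the
two routes from (0, 0) to (1, 1) agree. Changing the sign of the difference shifts a logarithm by a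
constant and leaves increments alone. -/
theorem logIncrement_square {γ δ : ℝ → ℂ} (hγ : Continuous γ) (hδ : Continuous δ)
    (h : ∀ s t, γ s ≠ δ t) :
    logIncrement (fun s ↦ γ s - δ 0) + logIncrement (fun t ↦ δ t - γ 1) =
      logIncrement (fun s ↦ γ s - δ 1) + logIncrement (fun t ↦ δ t - γ 0) := by
  obtain ⟨H, hH, hexp⟩ := Continuous.exists_exp_eq (X := ℝ × ℝ)
    (g := fun p ↦ γ p.1 - δ p.2) (by fun_prop) (fun p ↦ sub_ne_zero.2 (h _ _))
  have hs (t : ℝ) : logIncrement (fun s ↦ γ s - δ t) = H (1, t) - H (0, t) :=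
    logIncrement_eq (f := fun s ↦ H (s, t)) (by fun_prop) (fun s ↦ hexp (s, t))
  have ht (s : ℝ) : logIncrement (fun t ↦ δ t - γ s) = H (s, 1) - H (s, 0) := by
    rw [logIncrement_eq (f := fun t ↦ H (s, t) + Real.pi * I) (by fun_prop)]
    · ring
    · intro t
      rw [exp_add, hexp (s, t), exp_pi_mul_I]
      ring
  rw [hs, hs, ht, ht]
  ring

theorem exists_logIncrement_eq {γ : ℝ → ℂ} (hγ : Continuous γ) {v a b φ ψ : ℂ} (h : ∀ t, γ t ≠ v)
    (ha : γ 0 = a) (hb : γ 1 = b) (hφ : exp φ = a - v) (hψ : exp ψ = b - v) :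
    ∃ n : ℤ, logIncrement (fun t ↦ γ t - v) = ψ - φ + n * (2 * Real.pi * I) := by
  rw [← exp_eq_exp_iff_exists_int, exp_logIncrement (by fun_prop) (fun t ↦ sub_ne_zero.2 (h t)),
    ha, hb, exp_sub, hφ, hψ]

/-- In a drawing of `K₃,₃` in the plane, some two independent edges meet. -/
theorem exists_meet_of_drawing_completeBipartite {A C : Fin 3 → ℂ}
    (γ : ∀ i j, Path (A i) (C j)) :
    ∃ i k j l, i ≠ k ∧ j ≠ l ∧ ∃ x, x ∈ Set.range (γ i j) ∧ x ∈ Set.range (γ k l) := by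
  by_contra! hdis
  have hd {i k j l} (hik : i ≠ k) (hjl : j ≠ l) (s t : ℝ) :
      (γ i j).extend s ≠ (γ k l).extend t := by
    intro h
    refine hdis i k j l hik hjl ((γ i j).extend s) ?_ ?_
    · rw [← Path.extend_range]; exact ⟨s, rfl⟩
    · rw [h, ← Path.extend_range]; exact ⟨t, rfl⟩
  have hA {i k} (hik : i ≠ k) : A i ≠ A k := by
    simpa using hd hik (show (0 : Fin 3) ≠ 1 by decide) 0 0
  have hC {j l} (hjl : j ≠ l) : C j ≠ C l := by
    simpa using hd (show (0 : Fin 3) ≠ 1 by decide) hjl 1 1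
  have hAC (i j) : A i ≠ C j := by
    obtain ⟨k, hk⟩ := exists_ne i
    obtain ⟨l, hl⟩ := exists_ne j
    simpa using hd hk.symm hl 0 1
  have hvA {k i} (hki : k ≠ i) (j) (t : ℝ) : (γ i j).extend t ≠ A k := by
    obtain ⟨l, hl⟩ := exists_ne j
    simpa using hd hki.symm hl.symm t 0
  have hvC {l j} (hlj : l ≠ j) (i) (t : ℝ) : (γ i j).extend t ≠ C l := by
    obtain ⟨k, hk⟩ := exists_ne i
    simpa using hd hk.symm hlj.symm t 1
  -- Logarithms of `P k - P i` and `P i - P k` are chosen to differ by exactly πi, so that in `key`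
  -- the endpoint terms cancel up to 0 or 2πi.
  have arg (P : Fin 3 → ℂ) (hP : ∀ {i k}, i ≠ k → P i ≠ P k) : ∃ Φ : Fin 3 → Fin 3 → ℂ,
      (∀ {i k}, i ≠ k → exp (Φ i k) = P k - P i) ∧
      ∀ {i k}, i < k → Φ k i = Φ i k + Real.pi * I := by
    refine ⟨fun i k ↦ if i < k then log (P k - P i) else log (P i - P k) + Real.pi * I, ?_, ?_⟩
    · intro i k hik
      dsimp only
      split_ifs
      · exact exp_log (sub_ne_zero.2 (hP hik.symm))
      · rw [exp_add, exp_log (sub_ne_zero.2 (hP hik)), exp_pi_mul_I]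
        ring
    · intro i k hik
      simp [hik, hik.not_gt]
  obtain ⟨ΦA, hΦA, hΦA'⟩ := arg A hA
  obtain ⟨ΦC, hΦC, hΦC'⟩ := arg C hC
  have hlog (i j) : exp (log (C j - A i)) = C j - A i := exp_log (sub_ne_zero.2 (hAC i j).symm)
  have hlog' (i j) : exp (log (C j - A i) + Real.pi * I) = A i - C j := by
    rw [exp_add, hlog, exp_pi_mul_I]
    ring
  have nA (k i j) : ∃ n : ℤ, k ≠ i → logIncrement (fun t ↦ (γ i j).extend t - A k) =
      log (C j - A k) - ΦA k i + n * (2 * Real.pi * I) := by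
    by_cases hki : k = i
    · exact ⟨0, fun h ↦ absurd hki h⟩
    · obtain ⟨n, hn⟩ := exists_logIncrement_eq (γ i j).continuous_extend (hvA hki j)
        (γ i j).extend_zero (γ i j).extend_one (hΦA hki) (hlog k j)
      exact ⟨n, fun _ ↦ hn⟩
  have nC (l i j) : ∃ n : ℤ, l ≠ j → logIncrement (fun t ↦ (γ i j).extend t - C l) =
      ΦC l j - (log (C l - A i) + Real.pi * I) + n * (2 * Real.pi * I) := by
    by_cases hlj : l = j
    · exact ⟨0, fun h ↦ absurd hlj h⟩
    · obtain ⟨n, hn⟩ := exists_logIncrement_eq (γ i j).continuous_extend (hvC hlj i)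
        (γ i j).extend_zero (γ i j).extend_one (hlog' i l) (hΦC hlj)
      exact ⟨n, fun _ ↦ hn⟩
  choose nA hnA using nA
  choose nC hnC using nC
  have two_pi : (2 * Real.pi * I : ℂ) ≠ 0 := two_pi_I_ne_zero
  have key (i k j l) (hik : i < k) (hjl : j ≠ l) :
      nA k i j + nC j k l - nC l i j - nA i k l - (if j < l then 1 else 0) = 0 := by
    have hsq := logIncrement_square (γ i j).continuous_extend (γ k l).continuous_extend
      (hd hik.ne hjl)
    simp only [Path.extend_zero, Path.extend_one] at hsq
    rw [hnA _ _ _ hik.ne', hnA _ _ _ hik.ne, hnC _ _ _ hjl, hnC _ _ _ hjl.symm, hΦA' hik] at hsq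
    have : ((nA k i j + nC j k l - nC l i j - nA i k l - (if j < l then 1 else 0) : ℤ) : ℂ) = 0 := by
      apply (mul_eq_zero.1 _).resolve_right two_pi
      rcases hjl.lt_or_gt with h | h
      · rw [hΦC' h] at hsq
        rw [if_pos h]
        push_cast
        linear_combination hsq
      · rw [hΦC' h] at hsq
        rw [if_neg h.not_gt]
        push_cast
        linear_combination hsq
    exact_mod_cast this
  have e (i k : Fin 3) (hik : i < k) := And.intro (key i k 0 1 hik (by decide)) <|
    And.intro (key i k 1 0 hik (by decide)) <| And.intro (key i k 0 2 hik (by decide)) <|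
    And.intro (key i k 2 0 hik (by decide)) <| And.intro (key i k 1 2 hik (by decide)) <|
    key i k 2 1 hik (by decide)
  have h01 := e 0 1 (by decide)
  have h02 := e 0 2 (by decide)
  have h12 := e 1 2 (by decide)
  simp at h01 h02 h12
  -- Modulo 2 each integer unknown occurs in exactly two of the eighteen equations, while nine of
  -- them carry the constant 1: the sum reads 0 = 1.
  omega

end ContinuousLogarithm

/-! ### Outerplanar graphs exclude `K₂,₃`. -/

namespace SimpleGraph

variable {V : Type*} {G : SimpleGraph V}

namespace PlaneEmbedding

theorem isCompact_arc (D : G.PlaneEmbedding) (e : G.edgeSet) : IsCompact (D.arc e) := by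
  obtain ⟨e, he⟩ := e
  induction e with
  | _ u v =>
    obtain ⟨γ, -, hγ⟩ := D.isArc u v he
    rw [← hγ]
    exact isCompact_range γ.continuous

theorem isClosed_carrier [Finite V] (D : G.PlaneEmbedding) : IsClosed D.carrier := by
  refine (Set.finite_range D.point).isClosed.union ?_
  exact isClosed_iUnion_of_finite fun e ↦ (D.isCompact_arc e).isClosed

theorem IsFace.isOpen [Finite V] {D : G.PlaneEmbedding} {F : Set (EuclideanSpace ℝ (Fin 2))}
    (hF : D.IsFace F) : IsOpen F := by
  obtain ⟨x, -, rfl⟩ := hF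
  exact D.isClosed_carrier.isOpen_compl.connectedComponentIn

theorem IsFace.isPathConnected [Finite V] {D : G.PlaneEmbedding}
    {F : Set (EuclideanSpace ℝ (Fin 2))} (hF : D.IsFace F) : IsPathConnected F := by
  rw [← hF.isOpen.isConnected_iff_isPathConnected]
  obtain ⟨x, hx, rfl⟩ := hF
  exact isConnected_connectedComponentIn_iff.2 hx

theorem IsFace.subset {D : G.PlaneEmbedding} {F : Set (EuclideanSpace ℝ (Fin 2))}
    (hF : D.IsFace F) : F ⊆ D.carrierᶜ := by
  obtain ⟨x, -, rfl⟩ := hF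
  exact connectedComponentIn_subset _ _

/-- A vertex on the boundary of a face can be joined to any point of the face by a path that meets
only the arcs ending at that vertex. -/
theorem IsFace.exists_path [Finite V] {D : G.PlaneEmbedding}
    {F : Set (EuclideanSpace ℝ (Fin 2))} (hF : D.IsFace F) {p : EuclideanSpace ℝ (Fin 2)}
    (hp : p ∈ F) {c : V} (hc : D.point c ∈ frontier F) :
    ∃ γ : _root_.Path p (D.point c), ∀ e : G.edgeSet, c ∉ (e : Sym2 V) →
      Disjoint (Set.range γ) (D.arc e) := by
  let K : Set (EuclideanSpace ℝ (Fin 2)) := ⋃ e : {e : G.edgeSet // c ∉ (e : Sym2 V)}, D.arc e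
  have hK : IsClosed K := isClosed_iUnion_of_finite fun e ↦ (D.isCompact_arc e).isClosed
  have hcK : D.point c ∉ K := by
    simp only [K, Set.mem_iUnion, not_exists]
    exact fun e he ↦ e.2 (D.mem_of_point_mem_arc e c he)
  obtain ⟨ε, hε, hball⟩ := Metric.isOpen_iff.1 hK.isOpen_compl _ hcK
  obtain ⟨q, hqF, hq⟩ := Metric.mem_closure_iff.1 (frontier_subset_closure hc) ε hε
  have h1 : JoinedIn F p q := hF.isPathConnected.joinedIn _ hp _ hqF
  have h2 : JoinedIn (Metric.ball (D.point c) ε) q (D.point c) :=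
    (convex_ball _ _).isPathConnected ⟨_, Metric.mem_ball_self hε⟩ |>.joinedIn _
      (by rwa [Metric.mem_ball, _root_.dist_comm]) _ (Metric.mem_ball_self hε)
  refine ⟨h1.somePath.trans h2.somePath, fun e he ↦ ?_⟩
  rw [_root_.Path.trans_range, Set.disjoint_left]
  rintro _ (⟨t, rfl⟩ | ⟨t, rfl⟩) hx
  · exact hF.subset (h1.somePath_mem t) (Or.inr (Set.mem_iUnion.2 ⟨e, hx⟩))
  · exact hball (h2.somePath_mem t) (Set.mem_iUnion.2 ⟨⟨e, he⟩, hx⟩)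

theorem exists_path_of_walk (D : G.PlaneEmbedding) {S : Set V} {a b c : V} (w : G.Walk a b)
    (hw : ∀ v ∈ w.support, v ∈ S) (hbc : G.Adj b c) :
    ∃ γ : _root_.Path (D.point a) (D.point c), ∀ x ∈ Set.range γ, ∃ e : G.edgeSet, x ∈ D.arc e ∧
      ∀ v ∈ (e : Sym2 V), v ∈ S ∨ v = c := by
  induction w with
  | nil =>
    obtain ⟨γ, -, hγ⟩ := D.isArc _ _ hbc
    refine ⟨γ, fun x hx ↦ ⟨⟨_, hbc⟩, hγ ▸ hx, fun v hv ↦ ?_⟩⟩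
    rcases Sym2.mem_iff.1 hv with rfl | rfl
    · exact .inl (hw _ (by simp))
    · exact .inr rfl
  | @cons a a' b h w ih =>
    obtain ⟨γ, -, hγ⟩ := D.isArc _ _ h
    obtain ⟨δ, hδ⟩ := ih (fun v hv ↦ hw v (by simp [hv])) hbc
    refine ⟨γ.trans δ, fun x hx ↦ ?_⟩
    rw [_root_.Path.trans_range] at hx
    rcases hx with hx | hx
    · refine ⟨⟨_, h⟩, hγ ▸ hx, fun v hv ↦ .inl ?_⟩
      rcases Sym2.mem_iff.1 hv with rfl | rfl
      · exact hw _ (by simp)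
      · exact hw _ (by simp)
    · exact hδ x hx

/-- Lets a connected set play the role of one vertex of `K₃,₃`. Recording the ends of the arcs used
is what later shows that two such paths are disjoint. -/
theorem exists_path_of_connected (D : G.PlaneEmbedding) {S : Set V}
    (hS : (G.induce S).Connected) {a c : V} (ha : a ∈ S) (hc : ∃ b ∈ S, G.Adj b c) :
    ∃ γ : _root_.Path (D.point a) (D.point c), ∀ x ∈ Set.range γ, ∃ e : G.edgeSet, x ∈ D.arc e ∧
      ∀ v ∈ (e : Sym2 V), v ∈ S ∨ v = c := by
  obtain ⟨b, hb, hbc⟩ := hc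
  obtain ⟨w⟩ := hS.preconnected ⟨a, ha⟩ ⟨b, hb⟩
  have hw : ∀ v ∈ (w.map (Embedding.induce S).toHom).support, v ∈ S := by
    intro v hv
    rw [Walk.support_map, List.mem_map] at hv
    obtain ⟨v, -, rfl⟩ := hv
    exact v.2
  exact D.exists_path_of_walk (w.map (Embedding.induce S).toHom) hw hbc

end PlaneEmbedding

/-- The plane as the complex numbers. -/
def planeToComplex (x : EuclideanSpace ℝ (Fin 2)) : ℂ := ⟨x 0, x 1⟩

theorem continuous_planeToComplex : Continuous planeToComplex := by
  have : planeToComplex = fun x ↦ (x 0 : ℂ) + x 1 * Complex.I := by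
    ext x
    simp [planeToComplex, Complex.mk_eq_add_mul_I]
  rw [this]
  fun_prop

theorem planeToComplex_injective : Function.Injective planeToComplex := by
  intro x y h
  ext i
  fin_cases i
  · exact congrArg Complex.re h
  · exact congrArg Complex.im h

/-- An outerplanar graph has no `K₂,₃` minor, in the form in which the vertices of one side are
represented by single vertices. -/
theorem IsOuterplanar.false_of_connected_of_connected [Finite V] (hG : G.IsOuterplanar)
    {A B : Set V} (hA : (G.induce A).Connected) (hB : (G.induce B).Connected)
    (hAB : Disjoint A B) {c : Fin 3 → V} (hc : Function.Injective c) (hcA : ∀ i, c i ∉ A)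
    (hcB : ∀ i, c i ∉ B) (hadjA : ∀ i, ∃ a ∈ A, G.Adj a (c i))
    (hadjB : ∀ i, ∃ b ∈ B, G.Adj b (c i)) : False := by
  obtain ⟨D, F, hF, -, hfr⟩ := hG
  obtain ⟨⟨a, ha⟩⟩ := hA.nonempty
  obtain ⟨⟨b, hb⟩⟩ := hB.nonempty
  obtain ⟨p, hp⟩ := hF.isPathConnected.nonempty
  choose α hα using fun i ↦ D.exists_path_of_connected hA ha (hadjA i)
  choose β hβ using fun i ↦ D.exists_path_of_connected hB hb (hadjB i)
  choose π hπ using fun i ↦ hF.exists_path hp (hfr (c i))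
  have hαβ {j l x} (hjl : j ≠ l) (h1 : x ∈ Set.range (α j)) (h2 : x ∈ Set.range (β l)) : False := by
    obtain ⟨e, hxe, he⟩ := hα j x h1
    obtain ⟨f, hxf, hf⟩ := hβ l x h2
    have key {v} (h1 : v ∈ A ∨ v = c j) (h2 : v ∈ B ∨ v = c l) : False := by
      rcases h1 with h1 | rfl <;> rcases h2 with h2 | h2
      · exact Set.disjoint_left.1 hAB h1 h2
      · exact hcA _ (h2 ▸ h1)
      · exact hcB _ h2
      · exact hjl (hc h2)
    by_cases hef : e = f
    · subst hef
      obtain ⟨v, hv⟩ : ∃ v, v ∈ (e : Sym2 V) := by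
        obtain ⟨e, -⟩ := e
        induction e with
        | _ u v => exact ⟨u, by simp⟩
      exact key (he v hv) (hf v hv)
    · obtain ⟨w, hwe, hwf, -⟩ := D.arc_inter e f hef x hxe hxf
      exact key (he w hwe) (hf w hwf)
  have hout {S : Set V} (hS : ∀ i, c i ∉ S) {j l x} (hjl : j ≠ l)
      (h1 : ∃ e : G.edgeSet, x ∈ D.arc e ∧ ∀ v ∈ (e : Sym2 V), v ∈ S ∨ v = c j)
      (h2 : x ∈ Set.range (π l)) : False := by
    obtain ⟨e, hxe, he⟩ := h1
    refine Set.disjoint_left.1 (hπ l e fun hl ↦ ?_) h2 hxe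
    rcases he _ hl with h | h
    · exact hS l h
    · exact hjl (hc h).symm
  -- One side of `K₃,₃` consists of `a`, `b` and the point `p` of the face, the other of the three
  -- `c i`.
  obtain ⟨i, k, j, l, hik, hjl, z, h1, h2⟩ := exists_meet_of_drawing_completeBipartite
    (A := ![planeToComplex (D.point a), planeToComplex (D.point b), planeToComplex p])
    (C := fun j ↦ planeToComplex (D.point (c j)))
    (fun i j ↦ match i with
      | 0 => (α j).map continuous_planeToComplex
      | 1 => (β j).map continuous_planeToComplex
      | 2 => (π j).map continuous_planeToComplex)
  have meet {u u' v v' : EuclideanSpace ℝ (Fin 2)} {γ : _root_.Path u u'} {δ : _root_.Path v v'}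
      (h1 : z ∈ Set.range (γ.map continuous_planeToComplex))
      (h2 : z ∈ Set.range (δ.map continuous_planeToComplex)) :
      ∃ x, x ∈ Set.range γ ∧ x ∈ Set.range δ := by
    obtain ⟨s, hs⟩ := h1
    obtain ⟨t, rfl⟩ := h2
    exact ⟨γ s, ⟨s, rfl⟩, t, (planeToComplex_injective hs).symm⟩
  fin_cases i <;> fin_cases k
  · exact hik rfl
  · obtain ⟨x, h1, h2⟩ := meet h1 h2
    exact hαβ hjl h1 h2
  · obtain ⟨x, h1, h2⟩ := meet h1 h2
    exact hout hcA hjl (hα _ x h1) h2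
  · obtain ⟨x, h1, h2⟩ := meet h1 h2
    exact hαβ hjl.symm h2 h1
  · exact hik rfl
  · obtain ⟨x, h1, h2⟩ := meet h1 h2
    exact hout hcB hjl (hβ _ x h1) h2
  · obtain ⟨x, h1, h2⟩ := meet h1 h2
    exact hout hcA hjl.symm (hα _ x h2) h1
  · obtain ⟨x, h1, h2⟩ := meet h1 h2
    exact hout hcB hjl.symm (hβ _ x h2) h1
  · exact hik rfl

/-! ### Existence of a Hamiltonian cycle. -/

/-- The vertices `x :: t` form a cycle of `G` in this order. -/
structure IsCycleList (G : SimpleGraph V) (x : V) (t : List V) : Prop where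
  nodup : (x :: t).Nodup
  two_le : 2 ≤ t.length
  chain : List.IsChain G.Adj (x :: (t ++ [x]))

theorem IsCycleList.rotate {x y : V} {s t : List V} (h : G.IsCycleList x (s ++ y :: t)) :
    G.IsCycleList y (t ++ x :: s) := by
  have hperm : (y :: (t ++ x :: s)).Perm (x :: (s ++ y :: t)) := by
    rw [← List.cons_append, ← List.cons_append]
    exact List.perm_append_comm
  refine ⟨hperm.nodup_iff.2 h.nodup, by have := h.two_le; simp at this ⊢; omega, ?_⟩
  have h1 := h.chain
  rw [List.append_assoc, List.cons_append, ← List.cons_append, List.isChain_split] at h1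
  have h2 : List.IsChain G.Adj ((y :: t) ++ x :: (s ++ [y])) := by
    rw [List.isChain_split]
    exact ⟨by simpa using h1.2, by simpa using h1.1⟩
  simpa using h2

theorem connected_induce_of_isChain {l : List V} (hl : l ≠ []) (h : List.IsChain G.Adj l) :
    (G.induce {v | v ∈ l}).Connected := by
  induction l with
  | nil => exact absurd rfl hl
  | cons a l ih =>
    cases l with
    | nil =>
      have : {v | v ∈ [a]} = {a} := by ext; simp
      rw [this]
      have : Nonempty ({a} : Set V) := ⟨⟨a, rfl⟩⟩
      refine ⟨fun u v ↦ ?_⟩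
      rw [Subsingleton.elim u v]
    | cons b l =>
      rw [List.isChain_cons_cons] at h
      have h1 := connected_induce_union (G.induce_pair_connected_of_adj h.1).preconnected
        (ih (by simp) h.2).preconnected (v := a) (w := b) (by simp) (by simp) h.1
      have hs : {v | v ∈ a :: b :: l} = {a, b} ∪ {v | v ∈ b :: l} := by
        ext v
        simp
        tauto
      rwa [hs]

/-- Cuts the path at its first vertex `y` in `T`; with `T` on a cycle, this supplies the ear. -/
theorem exists_isChain_of_isPath {T : Set V} {a b : V} (w : G.Walk a b) (hw : w.IsPath)
    (ha : a ∉ T) (hb : b ∈ T) : ∃ (p : List V) (y : V), y ∈ T ∧ (a :: p).Nodup ∧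
      List.IsChain G.Adj (a :: (p ++ [y])) ∧ ∀ v ∈ a :: p, v ∉ T ∧ v ∈ w.support := by
  induction w with
  | nil => exact absurd hb ha
  | @cons a c b h w ih =>
    rw [Walk.cons_isPath_iff] at hw
    by_cases hc : c ∈ T
    · exact ⟨[], c, hc, by simp, by simpa using h, by simp [ha]⟩
    · obtain ⟨p, y, hy, h1, h2, h3⟩ := ih hw.1 hc hb
      refine ⟨c :: p, y, hy, ?_, ?_, ?_⟩
      · rw [List.nodup_cons]
        exact ⟨fun hap ↦ hw.2 (h3 a hap).2, h1⟩
      · rw [List.cons_append, List.isChain_cons_cons]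
        exact ⟨h, h2⟩
      · intro v hv
        rw [List.mem_cons] at hv
        rcases hv with rfl | hv
        · exact ⟨ha, by simp⟩
        · exact ⟨(h3 v hv).1, by simp [(h3 v hv).2]⟩

theorem IsKConnected.exists_isPath [Fintype V] (h : G.IsKConnected 2) {x a b : V} (ha : a ≠ x)
    (hb : b ≠ x) : ∃ w : G.Walk a b, w.IsPath ∧ x ∉ w.support := by
  classical
  obtain ⟨w⟩ := (h.2 {x} (by simp)).preconnected ⟨a, by simpa⟩ ⟨b, by simpa⟩
  have hw : x ∉ (w.map (Embedding.induce _).toHom).support := by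
    intro hv
    rw [Walk.support_map, List.mem_map] at hv
    obtain ⟨v, -, hv⟩ := hv
    exact v.2 (Finset.mem_singleton.2 hv)
  exact ⟨(w.map (Embedding.induce _).toHom).bypass, Walk.bypass_isPath _,
    fun hx ↦ hw (Walk.support_bypass_subset_support _ hx)⟩

theorem IsKConnected.connected [Fintype V] (h : G.IsKConnected 2) : G.Connected := by
  have h1 := h.2 ∅ (by simp)
  have : {v : V | v ∉ (∅ : Finset V)} = Set.univ := by simp
  rw [this] at h1
  exact (induceUnivIso G).connected_iff.1 h1

theorem IsKConnected.exists_isCycleList [Fintype V] (h : G.IsKConnected 2) {x a b : V}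
    (ha : G.Adj x a) (hb : G.Adj x b) (hab : a ≠ b) : ∃ t, G.IsCycleList x t := by
  obtain ⟨w, hw, hx⟩ := h.exists_isPath ha.ne' hb.ne'
  obtain ⟨p, y, rfl, h1, h2, h3⟩ := exists_isChain_of_isPath w hw (T := {b}) (by simpa) rfl
  refine ⟨a :: (p ++ [y]), ?_, by simp, ?_⟩
  · have hxp : x ∉ a :: p := fun hxp ↦ hx (h3 x hxp).2
    have hyp : y ∉ a :: p := fun hyp ↦ (h3 y hyp).1 rfl
    rw [List.nodup_cons, ← List.cons_append, List.nodup_append]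
    refine ⟨?_, h1, by simp, ?_⟩
    · simp only [List.mem_append, not_or]
      exact ⟨hxp, by simpa using hb.ne⟩
    · intro u hu v hv huv
      rw [List.mem_singleton] at hv
      exact hyp (by rwa [← hv, ← huv])
  · have : List.IsChain G.Adj ((x :: a :: p) ++ y :: [x]) := by
      rw [List.isChain_split]
      exact ⟨by simpa using ⟨ha, by simpa using h2⟩, by simpa using hb.symm⟩
    simpa using this

theorem exists_adj_of_isChain_cons_append {a y : V} {q : List V}
    (h : List.IsChain G.Adj (a :: (q ++ [y]))) : ∃ b ∈ q ++ [y], G.Adj a b := by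
  cases q with
  | nil => exact ⟨y, by simp, by simpa using h⟩
  | cons b q => exact ⟨b, by simp, (List.isChain_cons_cons.1 h).1⟩

/-- In a `2`-connected outerplanar graph a cycle that misses a vertex can be lengthened. -/
theorem IsCycleList.exists_longer [Fintype V] (hconn : G.IsKConnected 2)
    (hout : G.IsOuterplanar) {x : V} {t : List V} (h : G.IsCycleList x t) {v : V}
    (hv : v ∉ x :: t) : ∃ x' t', G.IsCycleList x' t' ∧ t.length < t'.length := by
  obtain ⟨w⟩ := hconn.connected.preconnected x v
  obtain ⟨e, -, hx', hd⟩ := w.exists_boundary_dart {u | u ∈ x :: t} (by simp) hv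
  -- Rotate the cycle so that it starts at a vertex with a neighbor `d` off the cycle.
  obtain ⟨x', t', h', hlen, hmem, d, hdx, hdt⟩ : ∃ x' t', G.IsCycleList x' t' ∧
      t.length = t'.length ∧ (∀ u, u ∈ x' :: t' ↔ u ∈ x :: t) ∧ ∃ d, G.Adj x' d ∧ d ∉ x' :: t' := by
    by_cases hex : e.fst = x
    · exact ⟨x, t, h, rfl, fun _ ↦ Iff.rfl, e.snd, hex ▸ e.adj, hd⟩
    · have : e.fst ∈ t := by
        have h' : e.fst ∈ x :: t := hx'
        exact (List.mem_cons.1 h').resolve_left hex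
      obtain ⟨s, r, rfl⟩ := List.append_of_mem this
      have hm : ∀ u, u ∈ e.fst :: (r ++ x :: s) ↔ u ∈ x :: (s ++ e.fst :: r) := by
        intro u
        simp only [List.mem_cons, List.mem_append]
        tauto
      exact ⟨e.fst, _, h.rotate, by simp; omega, hm, e.snd, e.adj, fun hd' ↦ hd ((hm _).1 hd')⟩
  rw [hlen]
  clear hmem hlen h hv hd hx' e w v x t
  rename' x' => x, t' => t, h' => h
  have hdx' : d ≠ x := fun hh ↦ hdt (by simp [hh])
  obtain ⟨z, hz⟩ : ∃ z, z ∈ t := List.exists_mem_of_length_pos (by have := h.two_le; omega)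
  have hxt : x ∉ t := (List.nodup_cons.1 h.nodup).1
  obtain ⟨w, hw, hxw⟩ := hconn.exists_isPath hdx' (b := z) (fun hh ↦ hxt (hh ▸ hz))
  obtain ⟨p, y, hyt, hp1, hp2, hp3⟩ := exists_isChain_of_isPath w hw (T := {v | v ∈ t})
    (fun hh ↦ hdt (by simp [show d ∈ t from hh])) hz
  have hxp : x ∉ d :: p := fun hh ↦ hxw (hp3 x hh).2
  have hpt : ∀ v ∈ d :: p, v ∉ t := fun v hv ↦ (hp3 v hv).1
  clear hp3 hz hw hxw w z
  obtain ⟨t₁, t₂, rfl⟩ := List.append_of_mem (show y ∈ t from hyt)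
  have hnd : (x :: (t₁ ++ y :: t₂ ++ d :: p)).Nodup := by
    rw [← List.cons_append, List.nodup_append]
    refine ⟨h.nodup, hp1, fun a ha b hb hab ↦ ?_⟩
    rcases List.mem_cons.1 ha with rfl | ha
    · exact hxp (hab ▸ hb)
    · exact hpt b hb (hab ▸ ha)
  have hch := h.chain
  rw [List.append_assoc, List.cons_append, ← List.cons_append, List.isChain_split] at hch
  obtain ⟨hch1, hch2⟩ := hch
  -- The ear runs from `x` through `d` to `y`. If `y` follows or precedes `x` on the cycle, the ear
  -- replaces the edge between them.
  cases t₁ with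
  | nil =>
    refine ⟨x, d :: p ++ y :: t₂, ⟨?_, ?_, ?_⟩, ?_⟩
    · refine (List.Perm.nodup_iff ?_).1 hnd
      exact (List.perm_append_comm).cons x
    · simp
      omega
    · have : List.IsChain G.Adj ((x :: d :: p) ++ y :: (t₂ ++ [x])) := by
        rw [List.isChain_split]
        exact ⟨by simpa using ⟨hdx, by simpa using hp2⟩, hch2⟩
      simpa using this
    · simp
  | cons c₁ t₁ =>
    rcases List.eq_nil_or_concat' t₂ with rfl | ⟨t₂', c₂, rfl⟩
    · refine ⟨x, c₁ :: t₁ ++ y :: (d :: p).reverse, ⟨?_, ?_, ?_⟩, ?_⟩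
      · refine (List.Perm.nodup_iff ?_).1 hnd
        refine List.Perm.cons x ?_
        rw [List.append_assoc]
        exact ((List.reverse_perm (d :: p)).symm.cons y).append_left (c₁ :: t₁)
      · simp; omega
      · have : List.IsChain G.Adj ((x :: c₁ :: t₁) ++ y :: ((d :: p).reverse ++ [x])) := by
          rw [List.isChain_split]
          refine ⟨hch1, ?_⟩
          have h1 : List.IsChain G.Adj (x :: d :: (p ++ [y])) := by
            rw [List.isChain_cons_cons]
            exact ⟨hdx, hp2⟩
          have h2 := List.isChain_reverse.2 (h1.imp fun a b hab ↦ hab.symm)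
          simpa using h2
        simpa using this
      · simp
    -- Otherwise `x` and the rest of the cycle together with the interior of the ear beyond `d` are
    -- the two hubs of a `K₂,₃` minor, on the cycle neighbors `c₁`, `c₂` of `x` and on `d`.
    exfalso
    rw [List.cons_append, List.cons_append, List.isChain_cons_cons] at hch1
    have hch2' : List.IsChain G.Adj (y :: (t₂' ++ [c₂])) := by
      rw [← List.cons_append] at hch2
      exact hch2.left_of_append
    have hxc₂ : G.Adj x c₂ := by
      have h1 : List.IsChain G.Adj ((y :: t₂') ++ c₂ :: [x]) := by simpa using hch2
      rw [List.isChain_split] at h1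
      exact (List.isChain_pair.1 h1.2).symm
    have hB₁ : (G.induce {v | v ∈ t₁ ++ y :: t₂'}).Connected := by
      refine connected_induce_of_isChain (by simp) ?_
      rw [List.isChain_split]
      refine ⟨hch1.2.tail, ?_⟩
      rw [← List.cons_append] at hch2'
      exact hch2'.left_of_append
    have hB₂ : (G.induce {v | v ∈ p ++ [y]}).Connected :=
      connected_induce_of_isChain (by simp) hp2.tail
    have hA : (G.induce {v | v ∈ [x]}).Connected :=
      connected_induce_of_isChain (by simp) (by simp)
    have hB := induce_union_connected hB₁.preconnected hB₂.preconnected ⟨y, by simp⟩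
    have hrev : List.IsChain G.Adj (c₂ :: (t₂'.reverse ++ [y])) := by
      simpa using List.isChain_reverse.2 (hch2'.imp fun a b hab ↦ hab.symm)
    obtain ⟨b₁, hb₁, hcb₁⟩ := exists_adj_of_isChain_cons_append hch1.2
    obtain ⟨b₂, hb₂, hcb₂⟩ := exists_adj_of_isChain_cons_append hrev
    obtain ⟨b₃, hb₃, hcb₃⟩ := exists_adj_of_isChain_cons_append hp2
    have hnd' : (c₁ :: c₂ :: d :: x :: (t₁ ++ y :: t₂' ++ p)).Nodup := by
      refine (List.Perm.nodup_iff ?_).1 hnd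
      rw [← Multiset.coe_eq_coe]
      simp only [← Multiset.cons_coe, ← Multiset.coe_add]
      simp only [← Multiset.singleton_add]
      abel
    simp only [List.nodup_cons, List.mem_cons, List.mem_append, not_or, List.nodup_append] at hnd'
    refine hout.false_of_connected_of_connected hA hB ?_ (c := ![c₁, c₂, d]) ?_ ?_ ?_ ?_ ?_
    · rw [Set.disjoint_left]
      intro u hu
      simp at hu ⊢
      grind
    · intro i j hij
      fin_cases i <;> fin_cases j <;> simp at hij ⊢ <;> grind
    · intro i
      fin_cases i <;> simp <;> grind
    · intro i
      fin_cases i <;> simp <;> grind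
    · intro i
      refine ⟨x, by simp, ?_⟩
      fin_cases i
      · exact hch1.1
      · exact hxc₂
      · exact hdx
    · intro i
      fin_cases i
      · exact ⟨b₁, by simp at hb₁ ⊢; tauto, hcb₁.symm⟩
      · exact ⟨b₂, by simp at hb₂ ⊢; tauto, hcb₂.symm⟩
      · exact ⟨b₃, by simp at hb₃ ⊢; tauto, hcb₃.symm⟩

theorem IsKConnected.exists_spanning_isCycleList [Fintype V] (hconn : G.IsKConnected 2)
    (hout : G.IsOuterplanar) {x a b : V} (ha : G.Adj x a) (hb : G.Adj x b) (hab : a ≠ b) :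
    ∃ x t, G.IsCycleList x t ∧ ∀ v, v ∈ x :: t := by
  by_contra! hno
  have key (k : ℕ) : ∃ x t, G.IsCycleList x t ∧ k ≤ t.length := by
    induction k with
    | zero =>
      obtain ⟨t, ht⟩ := hconn.exists_isCycleList ha hb hab
      exact ⟨x, t, ht, Nat.zero_le _⟩
    | succ k ih =>
      obtain ⟨x, t, ht, hk⟩ := ih
      obtain ⟨v, hv⟩ := hno x t ht
      obtain ⟨x', t', ht', hlt⟩ := ht.exists_longer hconn hout hv
      exact ⟨x', t', ht', by omega⟩
  obtain ⟨x, t, ht, hk⟩ := key (Fintype.card V)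
  have := ht.nodup.length_le_card
  simp at this
  omega

/-! ### Hamiltonian enumerations and non-crossing chords. -/

/-- `f` enumerates, periodically with period `n`, the vertices of a Hamiltonian cycle of `G`. -/
structure IsHamiltonianEnum (G : SimpleGraph V) (n : ℕ) (f : ℕ → V) : Prop where
  three_le : 3 ≤ n
  periodic : ∀ i, f (i + n) = f i
  adj : ∀ i, G.Adj (f i) (f (i + 1))
  ne : ∀ i j, i < j → j < i + n → f i ≠ f j
  surj : ∀ v, ∃ i < n, f i = v

theorem IsCycleList.isHamiltonianEnum {x : V} {t : List V} (h : G.IsCycleList x t)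
    (hall : ∀ v, v ∈ x :: t) :
    G.IsHamiltonianEnum (x :: t).length
      (fun i ↦ (x :: t)[i % (x :: t).length]'(Nat.mod_lt _ (by simp))) where
  three_le := by have := h.two_le; simp; omega
  periodic i := by simp
  adj i := by
    have hlt : i % (t.length + 1) < t.length + 1 := Nat.mod_lt _ (by simp)
    have hc := List.isChain_iff_getElem.1 h.chain (i % (t.length + 1)) (by simpa using hlt)
    simp only [List.length_cons]
    have h1 : (x :: (t ++ [x])) = (x :: t) ++ [x] := rfl
    simp only [h1] at hc
    rw [List.getElem_append_left (by simpa using hlt)] at hc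
    convert hc using 1
    simp only [← Nat.mod_add_mod i]
    rcases Nat.lt_or_ge (i % (t.length + 1) + 1) (t.length + 1) with hl | hl
    · rw [List.getElem_append_left (by simpa using hl)]
      simp only [Nat.mod_eq_of_lt hl]
    · have he : i % (t.length + 1) + 1 = t.length + 1 := by omega
      rw [List.getElem_append_right (by simpa using hl)]
      simp [he]
  ne i j hij hj heq := by
    have := (List.Nodup.getElem_inj_iff h.nodup).1 heq
    have h2 : (j - i) % (x :: t).length = 0 := Nat.sub_mod_eq_zero_of_mod_eq this.symm
    rw [Nat.mod_eq_of_lt (by omega)] at h2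
    omega
  surj v := by
    obtain ⟨i, hi, hv⟩ := List.mem_iff_getElem.1 (hall v)
    exact ⟨i, hi, by simp only [Nat.mod_eq_of_lt hi, hv]⟩

namespace IsHamiltonianEnum

variable {n : ℕ} {f : ℕ → V}

theorem periodic_mul (h : G.IsHamiltonianEnum n f) (i k : ℕ) : f (i + k * n) = f i := by
  induction k with
  | zero => simp
  | succ k ih => rw [Nat.succ_mul, ← add_assoc, h.periodic, ih]

theorem mod_eq (h : G.IsHamiltonianEnum n f) (i : ℕ) : f (i % n) = f i := by
  conv_rhs => rw [← Nat.mod_add_div i n, mul_comm, h.periodic_mul]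

theorem shift (h : G.IsHamiltonianEnum n f) (k : ℕ) : G.IsHamiltonianEnum n (fun i ↦ f (i + k)) where
  three_le := h.three_le
  periodic i := by rw [add_right_comm, h.periodic]
  adj i := by rw [add_right_comm]; exact h.adj _
  ne i j hij hj := h.ne _ _ (by omega) (by omega)
  surj v := by
    have hn := h.three_le
    obtain ⟨i, -, rfl⟩ := h.surj v
    have hk : k ≤ k * n := Nat.le_mul_of_pos_right k (by omega)
    refine ⟨(i + (k * n - k)) % n, Nat.mod_lt _ (by omega), ?_⟩
    rw [← h.mod_eq, Nat.mod_add_mod, h.mod_eq, show i + (k * n - k) + k = i + k * n by omega,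
      h.periodic_mul]

theorem ne' (h : G.IsHamiltonianEnum n f) {i j : ℕ} (hij : i ≠ j) (h1 : i < j + n)
    (h2 : j < i + n) : f i ≠ f j := by
  rcases hij.lt_or_gt with hlt | hlt
  · exact h.ne _ _ hlt h2
  · exact (h.ne _ _ hlt h1).symm

theorem card_eq [Fintype V] (h : G.IsHamiltonianEnum n f) : Fintype.card V = n := by
  rw [← Fintype.card_fin n]
  refine (Fintype.card_of_bijective (f := fun i : Fin n ↦ f i) ⟨?_, ?_⟩).symm
  · intro i j hij
    by_contra hne
    exact h.ne' (fun hh ↦ hne (Fin.ext hh)) (by omega) (by omega) hij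
  · intro v
    obtain ⟨i, hi, hv⟩ := h.surj v
    exact ⟨⟨i, hi⟩, hv⟩

theorem connected_image_Icc (h : G.IsHamiltonianEnum n f) {a b : ℕ} (hab : a ≤ b) :
    (G.induce (f '' Set.Icc a b)).Connected := by
  induction b, hab using Nat.le_induction with
  | base =>
    rw [Set.Icc_self, Set.image_singleton]
    have : {f a} = {v | v ∈ [f a]} := by ext; simp
    rw [this]
    exact connected_induce_of_isChain (by simp) (by simp)
  | succ b hab ih =>
    have hp := G.induce_pair_connected_of_adj (h.adj b)
    have := induce_union_connected ih.preconnected hp.preconnected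
      ⟨f b, ⟨b, by simpa using hab, rfl⟩, by simp⟩
    convert this using 2 <;>
    · have : Set.Icc a (b + 1) = Set.Icc a b ∪ {b, b + 1} := by
        ext i
        simp
        omega
      rw [this, Set.image_union, Set.image_pair]

/-- The gap between `l` and `i + n` provides the vertex at `i + n - 1`. The arcs `[i, j - 1]` and
`[k + 1, i + n - 2]` are both adjacent to it, to `j` and to `k`, the crossing edges supplying two of
these adjacencies. -/
theorem not_crossing_of_gap [Finite V] (h : G.IsHamiltonianEnum n f) (hout : G.IsOuterplanar)
    {i j k l : ℕ} (hij : i < j) (hjk : j < k) (hkl : k < l) (hl : l + 1 < i + n)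
    (hik : G.Adj (f i) (f k)) : ¬ G.Adj (f j) (f l) := by
  intro hjl
  have hn := h.three_le
  have hmem {a b c : ℕ} (ha : a ∈ Set.Icc b c) : f a ∈ f '' Set.Icc b c := ⟨a, ha, rfl⟩
  have hnot {a b c : ℕ} (hac : c < a + n) (hab : a < b + n) (ha : a ∉ Set.Icc b c) :
      f a ∉ f '' Set.Icc b c := by
    rintro ⟨d, hd, hda⟩
    have hne : a ≠ d := fun hh ↦ ha (hh ▸ hd)
    rw [Set.mem_Icc] at hd
    exact h.ne' hne (by omega) (by omega) hda.symm
  have adj_pred (a : ℕ) (ha : 0 < a) : G.Adj (f (a - 1)) (f a) := by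
    have := h.adj (a - 1)
    rwa [Nat.sub_add_cancel ha] at this
  refine hout.false_of_connected_of_connected (A := f '' Set.Icc i (j - 1))
    (B := f '' Set.Icc (k + 1) (i + n - 2)) (c := ![f (i + n - 1), f j, f k])
    (h.connected_image_Icc (by omega)) (h.connected_image_Icc (by omega)) ?_ ?_ ?_ ?_ ?_ ?_
  · rw [Set.disjoint_left]
    rintro _ ⟨a, ha, rfl⟩
    rw [Set.mem_Icc] at ha
    exact hnot (by omega) (by omega) (by simp; omega)
  · have h1 : f (i + n - 1) ≠ f j := h.ne' (by omega) (by omega) (by omega)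
    have h2 : f (i + n - 1) ≠ f k := h.ne' (by omega) (by omega) (by omega)
    have h3 : f j ≠ f k := h.ne' (by omega) (by omega) (by omega)
    intro a b hab
    fin_cases a <;> fin_cases b <;> simp at hab ⊢ <;> grind
  · intro a
    fin_cases a
    · exact hnot (by omega) (by omega) (by simp; omega)
    · exact hnot (by omega) (by omega) (by simp; omega)
    · exact hnot (by omega) (by omega) (by simp; omega)
  · intro a
    fin_cases a
    · exact hnot (by omega) (by omega) (by simp; omega)
    · exact hnot (by omega) (by omega) (by simp; omega)
    · exact hnot (by omega) (by omega) (by simp)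
  · intro a
    fin_cases a
    · refine ⟨f i, hmem (by simp; omega), ?_⟩
      rw [← h.periodic i]
      exact (adj_pred _ (by omega)).symm
    · exact ⟨_, hmem (by simp; omega), adj_pred j (by omega)⟩
    · exact ⟨_, hmem (by simp; omega), hik⟩
  · intro a
    fin_cases a
    · exact ⟨_, hmem (by simp; omega), adj_pred (i + n - 1) (by omega)⟩
    · exact ⟨_, hmem (by simp; omega), hjl.symm⟩
    · exact ⟨_, hmem (by simp; omega), (h.adj k).symm⟩

/-- Two chords of a Hamiltonian cycle of an outerplanar graph with at least five vertices do not
cross. -/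
theorem not_crossing [Finite V] (h : G.IsHamiltonianEnum n f) (hout : G.IsOuterplanar)
    (hn : 5 ≤ n) {i j k l : ℕ} (hij : i < j) (hjk : j < k) (hkl : k < l) (hl : l < i + n)
    (hik : G.Adj (f i) (f k)) : ¬ G.Adj (f j) (f l) := by
  intro hjl
  -- With five vertices, one of the four arcs between consecutive ends has an inner vertex; rotating
  -- makes it the last arc.
  by_cases h1 : l + 1 < i + n
  · exact h.not_crossing_of_gap hout hij hjk hkl h1 hik hjl
  by_cases h2 : i + 1 < j
  · exact h.not_crossing_of_gap hout hjk hkl hl (by omega) hjl (by rw [h.periodic]; exact hik.symm)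
  by_cases h3 : j + 1 < k
  · exact h.not_crossing_of_gap hout hkl hl (l := j + n) (by omega) (by omega)
      (by rw [h.periodic]; exact hik.symm) (by rw [h.periodic]; exact hjl.symm)
  · exact h.not_crossing_of_gap hout hl (k := j + n) (l := k + n) (by omega) (by omega) (by omega)
      (by rw [h.periodic]; exact hjl.symm) (by rw [h.periodic, h.periodic]; exact hik)

end IsHamiltonianEnum

/-! ### Lower bounds. -/

theorem IsIntervalColoring.ne {t : ℕ} {α : G.edgeSet → ℕ} (hα : G.IsIntervalColoring t α)
    {v a b : V} (ha : G.Adj v a) (hb : G.Adj v b) (hab : a ≠ b) :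
    α ⟨s(v, a), ha⟩ ≠ α ⟨s(v, b), hb⟩ :=
  hα.proper _ _ (fun h ↦ hab (Sym2.congr_right.1 (congrArg Subtype.val h))) v (by simp) (by simp)

theorem IsIntervalColoring.three_le {t : ℕ} {α : G.edgeSet → ℕ} (hα : G.IsIntervalColoring t α)
    {v a b c : V} (ha : G.Adj v a) (hb : G.Adj v b) (hc : G.Adj v c) (hab : a ≠ b) (hac : a ≠ c)
    (hbc : b ≠ c) : 3 ≤ t := by
  have hr (e : G.edgeSet) : 1 ≤ α e ∧ α e ≤ t := by
    rw [← Set.mem_Icc, ← hα.range_eq]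
    exact ⟨e, rfl⟩
  have := hr ⟨s(v, a), ha⟩
  have := hr ⟨s(v, b), hb⟩
  have := hr ⟨s(v, c), hc⟩
  have := hα.ne ha hb hab
  have := hα.ne ha hc hac
  have := hα.ne hb hc hbc
  omega

/-- The edges of color `2` of an interval `3`-coloring form a perfect matching. -/
theorem IsIntervalColoring.even_card [Fintype V] {α : G.edgeSet → ℕ}
    (hα : G.IsIntervalColoring 3 α)
    (hdeg : ∀ v, ∃ a b, G.Adj v a ∧ G.Adj v b ∧ a ≠ b) : Even (Fintype.card V) := by
  let M : G.Subgraph :=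
    { verts := Set.univ
      Adj := fun u v ↦ ∃ h : G.Adj u v, α ⟨s(u, v), h⟩ = 2
      adj_sub := fun h ↦ h.1
      edge_vert := fun _ ↦ Set.mem_univ _
      symm := ⟨fun u v ⟨h, h2⟩ ↦ ⟨h.symm, by
        rw [← h2]
        congr 2
        exact Sym2.eq_swap⟩⟩ }
  have hM : M.IsPerfectMatching := by
    rw [Subgraph.isPerfectMatching_iff]
    intro v
    obtain ⟨a, b, ha, hb, hab⟩ := hdeg v
    have hr (e : G.edgeSet) : 1 ≤ α e ∧ α e ≤ 3 := by
      rw [← Set.mem_Icc, ← hα.range_eq]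
      exact ⟨e, rfl⟩
    -- Two distinct colors from 1, 2, 3 either include 2 or are 1 and 3, with 2 between them.
    have key : 2 ∈ colorsAt α v := by
      have h1 : α ⟨s(v, a), ha⟩ ∈ colorsAt α v := ⟨⟨s(v, a), ha⟩, by simp, rfl⟩
      have h2 : α ⟨s(v, b), hb⟩ ∈ colorsAt α v := ⟨⟨s(v, b), hb⟩, by simp, rfl⟩
      have hne := hα.ne ha hb hab
      have := hr ⟨s(v, a), ha⟩
      have := hr ⟨s(v, b), hb⟩
      rcases le_total (α ⟨s(v, a), ha⟩) (α ⟨s(v, b), hb⟩) with hle | hle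
      · exact (hα.interval v).out h1 h2 ⟨by omega, by omega⟩
      · exact (hα.interval v).out h2 h1 ⟨by omega, by omega⟩
    obtain ⟨⟨e, he⟩, hve, h2⟩ := key
    obtain ⟨w, rfl⟩ := hve
    refine ⟨w, ⟨he, h2⟩, ?_⟩
    rintro u ⟨hu, hu2⟩
    by_contra hne
    exact hα.ne hu he hne (hu2.trans h2.symm)
  exact hM.even_card

/-! ### Colorings described along the Hamiltonian cycle. -/

/-- The case `c = a` serves vertices without a chord, where only two colors are present. Three
distinct integers at pairwise distance at most 2 are consecutive. -/
theorem ordConnected_of_forall_mem {s : Set ℕ} {a b c : ℕ} (h : ∀ x, x ∈ s ↔ x = a ∨ x = b ∨ x = c)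
    (hab : a ≠ b) (hc : c = a ∧ (a = b + 1 ∨ b = a + 1) ∨ c ≠ a ∧ c ≠ b ∧ a ≤ b + 2 ∧ b ≤ a + 2 ∧
      a ≤ c + 2 ∧ c ≤ a + 2 ∧ b ≤ c + 2 ∧ c ≤ b + 2) : s.OrdConnected := by
  refine ⟨fun x hx y hy z hz ↦ ?_⟩
  rw [h] at hx hy ⊢
  rw [Set.mem_Icc] at hz
  omega

/-- The color of the edge between the positions `i` and `j` of a cycle of length `n`, where `e k`
is the color of the cycle edge from `k` to the next position and `g k` that of the chord at `k`. -/
def cycleColor (n : ℕ) (e g : ℕ → ℕ) (i j : ℕ) : ℕ :=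
  if max i j = min i j + 1 then e (min i j)
  else if min i j = 0 ∧ max i j + 1 = n then e (max i j)
  else g (min i j)

theorem cycleColor_comm (n : ℕ) (e g : ℕ → ℕ) (i j : ℕ) :
    cycleColor n e g i j = cycleColor n e g j i := by
  simp only [cycleColor, min_comm, max_comm]

namespace IsHamiltonianEnum

variable {n : ℕ} {f : ℕ → V}

/-- `f i` and `f j` are joined by an edge that is not on the cycle. -/
def IsChord (G : SimpleGraph V) (n : ℕ) (f : ℕ → V) (i j : ℕ) : Prop :=
  i < n ∧ j < n ∧ G.Adj (f i) (f j) ∧ i + 1 ≠ j ∧ j + 1 ≠ i ∧ ¬(i = 0 ∧ j + 1 = n) ∧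
    ¬(j = 0 ∧ i + 1 = n)

theorem IsChord.symm {i j : ℕ} (h : IsChord G n f i j) : IsChord G n f j i := by
  obtain ⟨h1, h2, h3, h4, h5, h6, h7⟩ := h
  exact ⟨h2, h1, h3.symm, h5, h4, h7, h6⟩

/-- Two chords and two cycle edges would give a vertex of degree at least 4. -/
theorem IsChord.unique [Fintype V] [DecidableRel G.Adj] (h : G.IsHamiltonianEnum n f)
    (hdeg : G.maxDegree ≤ 3) {i j k : ℕ} (hj : IsChord G n f i j) (hk : IsChord G n f i k) :
    j = k := by
  classical
  by_contra hjk
  have hn := h.three_le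
  obtain ⟨hi, hj, haj, hj1, hj2, hj3, hj4⟩ := hj
  obtain ⟨-, hk, hak, hk1, hk2, hk3, hk4⟩ := hk
  have hS : ({f j, f k, f (i + 1), f (i + n - 1)} : Finset V) ⊆ G.neighborFinset (f i) := by
    intro v hv
    simp only [Finset.mem_insert, Finset.mem_singleton] at hv
    rw [mem_neighborFinset]
    rcases hv with rfl | rfl | rfl | rfl
    · exact haj
    · exact hak
    · exact h.adj i
    · have := (h.adj (i + n - 1)).symm
      rwa [Nat.sub_add_cancel (by omega), h.periodic] at this
  have hne {a b : ℕ} (ha : a < n) (hb : b < 2 * n - 1) (hab : a ≠ b) (hab' : a + n ≠ b) :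
      f a ≠ f b := by
    rcases Nat.lt_or_ge b n with hbn | hbn
    · exact h.ne' hab (by omega) (by omega)
    · rw [show b = (b - n) + n by omega, h.periodic]
      exact h.ne' (by omega) (by omega) (by omega)
  have h1 : f j ≠ f k := hne hj (by omega) hjk (by omega)
  have h2 : f j ≠ f (i + 1) := hne hj (by omega) (by omega) (by omega)
  have h3 : f k ≠ f (i + 1) := hne hk (by omega) (by omega) (by omega)
  have h4 : f j ≠ f (i + n - 1) := hne hj (by omega) (by omega) (by omega)
  have h5 : f k ≠ f (i + n - 1) := hne hk (by omega) (by omega) (by omega)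
  have h6 : f (i + 1) ≠ f (i + n - 1) :=
    h.ne' (by omega) (by omega) (by omega)
  have hcard : ({f j, f k, f (i + 1), f (i + n - 1)} : Finset V).card = 4 := by
    rw [Finset.card_insert_of_notMem (by simp [h1, h2, h4]),
      Finset.card_insert_of_notMem (by simp [h3, h5]), Finset.card_pair h6]
  have := Finset.card_le_card hS
  rw [hcard, card_neighborFinset_eq_degree] at this
  have := G.degree_le_maxDegree (f i)
  omega

/-- Reduces the construction to arithmetic: `p` is the cyclic predecessor of `i`, so `e p`, `e i`
and, if there is a chord, `g i` are all the colors at `f i`. -/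
theorem exists_coloring (h : G.IsHamiltonianEnum n f) (e g : ℕ → ℕ)
    (huniq : ∀ {i j k}, IsChord G n f i j → IsChord G n f i k → j = k)
    (hg : ∀ {i j}, IsChord G n f i j → g i = g j)
    (he : ∀ i < n, ∀ p, p < n → (p + 1 = i ∨ i = 0 ∧ p + 1 = n) → e i ≠ e p ∧
      ((¬ ∃ j, IsChord G n f i j) → e i = e p + 1 ∨ e p = e i + 1) ∧
      ((∃ j, IsChord G n f i j) → g i ≠ e i ∧ g i ≠ e p ∧ e i ≤ e p + 2 ∧ e p ≤ e i + 2 ∧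
        e i ≤ g i + 2 ∧ g i ≤ e i + 2 ∧ e p ≤ g i + 2 ∧ g i ≤ e p + 2)) :
    ∃ α : G.edgeSet → ℕ,
      (∀ e f : G.edgeSet, e ≠ f → ∀ v : V, v ∈ (e : Sym2 V) → v ∈ (f : Sym2 V) → α e ≠ α f) ∧
      (∀ v : V, (colorsAt α v).OrdConnected) ∧
      Set.range α = {c | (∃ i < n, c = e i) ∨ ∃ i j, IsChord G n f i j ∧ c = g i} := by
  have hn := h.three_le
  choose pos hpos hfpos using h.surj
  have hinj {i j : ℕ} (hi : i < n) (hj : j < n) (hij : f i = f j) : i = j := by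
    by_contra hne
    exact h.ne' hne (by omega) (by omega) hij
  have hposf {i : ℕ} (hi : i < n) : pos (f i) = i := hinj (hpos _) hi (hfpos _)
  let α : G.edgeSet → ℕ := fun s ↦ Sym2.lift
    ⟨fun u v ↦ cycleColor n e g (pos u) (pos v), fun u v ↦ cycleColor_comm _ _ _ _ _⟩ s
  have hα (u v : V) (huv : G.Adj u v) : α ⟨s(u, v), huv⟩ = cycleColor n e g (pos u) (pos v) := rfl
  have hnext {i j : ℕ} (hij : i + 1 = j) : cycleColor n e g i j = e i := by
    simp [cycleColor, ← hij]
  have hlast {i j : ℕ} (hi : i = 0) (hj : j + 1 = n) : cycleColor n e g i j = e j := by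
    subst hi
    have h1 : j ≠ 1 := by omega
    simp [cycleColor, h1, hj]
  have hchord {i j : ℕ} (hij : IsChord G n f i j) : cycleColor n e g i j = g i := by
    have h' := hij
    obtain ⟨h1, h2, h3, h4, h5, h6, h7⟩ := hij
    rcases le_total i j with hle | hle
    · simp only [cycleColor, min_eq_left hle, max_eq_right hle]
      rw [if_neg (by omega), if_neg (by omega)]
    · simp only [cycleColor, min_eq_right hle, max_eq_left hle]
      rw [if_neg (by omega), if_neg (by omega), hg h']
  have nbrs (i : ℕ) (hi : i < n) : ∃ q p, q < n ∧ p < n ∧ q ≠ p ∧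
      (p + 1 = i ∨ i = 0 ∧ p + 1 = n) ∧ (i + 1 = q ∨ q = 0 ∧ i + 1 = n) ∧
      G.Adj (f i) (f q) ∧ G.Adj (f i) (f p) ∧ cycleColor n e g i q = e i ∧
      cycleColor n e g i p = e p ∧ ∀ j < n, G.Adj (f i) (f j) → j = q ∨ j = p ∨ IsChord G n f i j := by
    have hwrap : G.Adj (f (n - 1)) (f 0) := by
      have h1 := h.adj (n - 1)
      have h2 := h.periodic 0
      rw [zero_add] at h2
      rwa [Nat.sub_add_cancel (by omega), h2] at h1
    refine ⟨if i + 1 = n then 0 else i + 1, if i = 0 then n - 1 else i - 1, ?_⟩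
    have adj_pred (ha : 0 < i) : G.Adj (f (i - 1)) (f i) := by
      have := h.adj (i - 1)
      rwa [Nat.sub_add_cancel ha] at this
    have hrest (q p : ℕ) (hqn : q < n) (hp : p + 1 = i ∨ i = 0 ∧ p + 1 = n)
        (hq : i + 1 = q ∨ q = 0 ∧ i + 1 = n) (j : ℕ) (hj : j < n) (hadj : G.Adj (f i) (f j)) : j = q ∨ j = p ∨ IsChord G n f i j := by
      by_cases h1 : j = q
      · exact .inl h1
      by_cases h2 : j = p
      · exact .inr (.inl h2)
      exact .inr (.inr ⟨hi, hj, hadj, by omega, by omega, by omega, by omega⟩)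
    by_cases h1 : i + 1 = n
    · have h2 : i ≠ 0 := by omega
      obtain rfl : n - 1 = i := by omega
      rw [if_pos h1, if_neg h2]
      exact ⟨by omega, by omega, by omega, by omega, by omega, hwrap,
        (adj_pred (by omega)).symm, by rw [cycleColor_comm, hlast rfl h1],
        by rw [cycleColor_comm, hnext (by omega)], hrest _ _ (by omega) (by omega) (by omega)⟩
    · by_cases h2 : i = 0
      · subst h2
        rw [if_neg h1, if_pos rfl]
        exact ⟨by omega, by omega, by omega, by omega, by omega, h.adj 0, hwrap.symm,
          hnext rfl, hlast rfl (by omega), hrest _ _ (by omega) (by omega) (by omega)⟩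
      · rw [if_neg h1, if_neg h2]
        exact ⟨by omega, by omega, by omega, by omega, by omega, h.adj i,
          (adj_pred (by omega)).symm, hnext rfl,
          by rw [cycleColor_comm, hnext (by omega)], hrest _ _ (by omega) (by omega) (by omega)⟩
  have mem_colors (i : ℕ) (hi : i < n) (c : ℕ) : c ∈ colorsAt α (f i) ↔
      ∃ j < n, G.Adj (f i) (f j) ∧ cycleColor n e g i j = c := by
    constructor
    · rintro ⟨⟨s, hs⟩, ⟨w, rfl⟩, rfl⟩
      refine ⟨pos w, hpos w, by rw [hfpos]; exact hs, ?_⟩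
      rw [hα _ _ hs, hposf hi]
    · rintro ⟨j, hj, hadj, rfl⟩
      exact ⟨⟨s(f i, f j), hadj⟩, by simp, by rw [hα _ _ hadj, hposf hi, hposf hj]⟩
  refine ⟨α, ?_, ?_, ?_⟩
  · rintro ⟨s, hs⟩ ⟨s', hs'⟩ hne v ⟨u, rfl⟩ ⟨w, rfl⟩
    have huw : pos u ≠ pos w := fun hh ↦ by
      have : u = w := by rw [← hfpos u, hh, hfpos]
      exact hne (by simp [this])
    rw [hα _ _ hs, hα _ _ hs']
    obtain ⟨q, p, hq, hp, hqp, hp', hq', haq, hap, hcq, hcp, hall⟩ := nbrs (pos v) (hpos v)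
    obtain ⟨he1, he2, he3⟩ := he (pos v) (hpos v) p hp hp'
    have hu := hall (pos u) (hpos u) (by rw [hfpos, hfpos]; exact hs)
    have hw := hall (pos w) (hpos w) (by rw [hfpos, hfpos]; exact hs')
    rcases hu with hu | hu | hu <;> rcases hw with hw | hw | hw
    · exact absurd (hu.trans hw.symm) huw
    · rw [hu, hw, hcq, hcp]; exact he1
    · rw [hu, hcq, hchord hw]; exact (he3 ⟨_, hw⟩).1.symm
    · rw [hu, hw, hcq, hcp]; exact he1.symm
    · exact absurd (hu.trans hw.symm) huw
    · rw [hu, hcp, hchord hw]; exact (he3 ⟨_, hw⟩).2.1.symm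
    · rw [hw, hcq, hchord hu]; exact (he3 ⟨_, hu⟩).1
    · rw [hw, hcp, hchord hu]; exact (he3 ⟨_, hu⟩).2.1
    · exact absurd (huniq hu hw) huw
  · intro v
    obtain ⟨i, hi, rfl⟩ := h.surj v
    obtain ⟨q, p, hq, hp, hqp, hp', hq', haq, hap, hcq, hcp, hall⟩ := nbrs i hi
    obtain ⟨he1, he2, he3⟩ := he i hi p hp hp'
    by_cases hex : ∃ j, IsChord G n f i j
    · obtain ⟨j, hj⟩ := hex
      refine ordConnected_of_forall_mem (a := e i) (b := e p) (c := g i) (fun c ↦ ?_) he1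
        (.inr (he3 ⟨j, hj⟩))
      rw [mem_colors i hi]
      constructor
      · rintro ⟨k, hk, hadj, rfl⟩
        rcases hall k hk hadj with rfl | rfl | hk
        · exact .inl hcq
        · exact .inr (.inl hcp)
        · exact .inr (.inr (hchord hk))
      · rintro (rfl | rfl | rfl)
        · exact ⟨q, hq, haq, hcq⟩
        · exact ⟨p, hp, hap, hcp⟩
        · exact ⟨j, hj.2.1, hj.2.2.1, hchord hj⟩
    · refine ordConnected_of_forall_mem (a := e i) (b := e p) (c := e i) (fun c ↦ ?_) he1
        (.inl ⟨rfl, he2 hex⟩)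
      rw [mem_colors i hi]
      constructor
      · rintro ⟨k, hk, hadj, rfl⟩
        rcases hall k hk hadj with rfl | rfl | hk
        · exact .inl hcq
        · exact .inr (.inl hcp)
        · exact absurd ⟨k, hk⟩ hex
      · rintro (rfl | rfl | rfl)
        · exact ⟨q, hq, haq, hcq⟩
        · exact ⟨p, hp, hap, hcp⟩
        · exact ⟨q, hq, haq, hcq⟩
  · ext c
    constructor
    · rintro ⟨⟨s, hs⟩, rfl⟩
      induction s with
      | _ u v =>
        obtain ⟨q, p, hq, hp, hqp, hp', hq', haq, hap, hcq, hcp, hall⟩ := nbrs (pos u) (hpos u)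
        rw [hα _ _ hs]
        rcases hall (pos v) (hpos v) (by rw [hfpos, hfpos]; exact hs) with hv | hv | hv
        · exact .inl ⟨pos u, hpos u, by rw [hv, hcq]⟩
        · exact .inl ⟨p, hp, by rw [hv, hcp]⟩
        · exact .inr ⟨_, _, hv, hchord hv⟩
    · rintro (⟨i, hi, rfl⟩ | ⟨i, j, hij, rfl⟩)
      · obtain ⟨q, p, hq, hp, hqp, hp', hq', haq, hap, hcq, hcp, hall⟩ := nbrs i hi
        exact ⟨⟨s(f i, f q), haq⟩, by rw [hα _ _ haq, hposf hi, hposf hq, hcq]⟩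
      · exact ⟨⟨s(f i, f j), hij.2.2.1⟩, by rw [hα _ _ hij.2.2.1, hposf hij.1, hposf hij.2.1, hchord hij]⟩

theorem exists_isIntervalColoring_three (h : G.IsHamiltonianEnum n f)
    (huniq : ∀ {i j k}, IsChord G n f i j → IsChord G n f i k → j = k)
    (hchord : ∃ i j, IsChord G n f i j) (hn : Even n) : ∃ α, G.IsIntervalColoring 3 α := by
  have h3 := h.three_le
  obtain ⟨m, hm⟩ := hn
  obtain ⟨α, h1, h2, hr⟩ := h.exists_coloring (fun i ↦ 1 + i % 2) (fun _ ↦ 3) huniq (fun _ ↦ rfl)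
    (fun i hi p hp hip ↦ ⟨by omega, fun _ ↦ by omega, fun _ ↦ by omega⟩)
  refine ⟨α, ?_, h1, h2⟩
  rw [hr]
  ext c
  rw [Set.mem_Icc]
  constructor
  · rintro (⟨i, hi, rfl⟩ | ⟨i, j, hij, rfl⟩) <;> omega
  · intro hc
    by_cases hc3 : c = 3
    · obtain ⟨i, j, hij⟩ := hchord
      exact .inr ⟨i, j, hij, hc3⟩
    · exact .inl ⟨c - 1, by omega, by omega⟩

/-- If `n` is odd, some chord cuts off an odd number of edges; take the least such number. -/
theorem exists_shortest_odd_chord (h : G.IsHamiltonianEnum n f)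
    (hchord : ∃ i j, IsChord G n f i j) (hn : Odd n) :
    ∃ f' m, G.IsHamiltonianEnum n f' ∧ Odd m ∧ IsChord G n f' 0 m ∧
      ∀ i j, i < j → j < i + m → Odd (j - i) → i + 1 ≠ j → ¬ G.Adj (f' i) (f' j) := by
  classical
  have hex : ∃ m, Odd m ∧ 3 ≤ m ∧ m + 2 ≤ n ∧ ∃ i, G.Adj (f i) (f (i + m)) := by
    obtain ⟨i, j, hij⟩ := hchord
    wlog hlt : i < j generalizing i j
    · refine this j i hij.symm ?_
      have := hij.2.2.1.ne
      have : i ≠ j := fun hh ↦ this (by rw [hh])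
      omega
    obtain ⟨hi, hj, hadj, h1, h2, h3, h4⟩ := hij
    rcases Nat.even_or_odd (j - i) with he | ho
    · have hodd : Odd (i + n - j) := by
        have : i + n - j = n - (j - i) := by omega
        rw [this]
        exact Nat.Odd.sub_even (by omega) hn he
      have hodd' := hodd
      rw [Nat.odd_iff] at hodd'
      refine ⟨i + n - j, hodd, by omega, ?_, j, ?_⟩
      · rw [Nat.even_iff] at he; omega
      · rw [show j + (i + n - j) = i + n by omega, h.periodic]
        exact hadj.symm
    · have ho' := ho
      rw [Nat.odd_iff] at ho' hn
      exact ⟨j - i, ho, by omega, by omega, i, by rwa [show i + (j - i) = j by omega]⟩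
  obtain ⟨hm, h3, hmn, i, hi⟩ := Nat.find_spec hex
  refine ⟨fun k ↦ f (k + i), Nat.find hex, h.shift i, hm, ?_, ?_⟩
  · refine ⟨by omega, by omega, ?_, by omega, by omega, by omega, by omega⟩
    simpa [add_comm] using hi
  · intro a b hab hb hodd hne hadj
    have hodd' := hodd
    rw [Nat.odd_iff] at hodd'
    refine Nat.find_min hex (m := b - a) (by omega) ⟨hodd, by omega, by omega, a + i, ?_⟩
    rwa [show a + i + (b - a) = b + i by omega]

/-- Going round from 0, the cycle edges alternate 4, 3 up to edge `p`, then 2, 3 up to edge `m - 1`,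
then 1, 2 back to 0. Only at 0 do neighboring cycle edges differ by 2, and the chord from 0 to `m`
fills the gap with 3. Chords inside the three ranges of vertices get 2, 1 and 3; no chord joins
different ranges, by non-crossing. -/
theorem exists_isIntervalColoring_four [Finite V] (h : G.IsHamiltonianEnum n f)
    (hout : G.IsOuterplanar)
    (huniq : ∀ {f : ℕ → V}, G.IsHamiltonianEnum n f →
      ∀ {i j k}, IsChord G n f i j → IsChord G n f i k → j = k)
    (hchord : ∃ i j, IsChord G n f i j) (hn : Odd n) : ∃ α, G.IsIntervalColoring 4 α := by
  obtain ⟨f, m, h, hm, h0m, hmin⟩ := h.exists_shortest_odd_chord hchord hn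
  have huniq' := @huniq f h
  have h0m' := h0m
  obtain ⟨-, hmn, -, hm1, -, hm2, -⟩ := h0m'
  have hm' := hm
  rw [Nat.odd_iff] at hm' hn
  have hcross {i j k l : ℕ} (hij : i < j) (hjk : j < k) (hkl : k < l) (hik : IsChord G n f i k)
      (hjl : IsChord G n f j l) : False :=
    h.not_crossing hout (by omega) hij hjk hkl (by have := hjl.2.1; omega) hik.2.2.1 hjl.2.2.1
  have hne {i j : ℕ} (hij : IsChord G n f i j) : i ≠ j := fun hh ↦ hij.2.2.1.ne (by rw [hh])
  -- the segment `[1, p]` is closed under chords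
  obtain ⟨p, hp, hpm, hp1⟩ : ∃ p, p % 2 = 1 ∧ p < m ∧
      ((p = 1 ∧ ∀ j, ¬ IsChord G n f 1 j) ∨ IsChord G n f 1 p) := by
    by_cases hex : ∃ p, IsChord G n f 1 p
    · obtain ⟨p, hp⟩ := hex
      have hp' := hp
      obtain ⟨-, hpn, hadj, hp1, hp2, hp3, hp4⟩ := hp'
      have hpm : p ≠ m := by
        rintro rfl
        have := huniq' hp.symm h0m.symm
        omega
      have hpm' : p < m := by
        by_contra hle
        exact hcross (by omega) (by omega) (by omega) h0m hp
      have := hne hp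
      refine ⟨p, ?_, hpm', .inr hp⟩
      -- For even `p` this chord would cut off `p - 1` edges, an odd number below `m`.
      by_contra hodd
      refine hmin 1 p (by omega) (by omega) ?_ (by omega) hadj
      rw [Nat.odd_iff]
      omega
    · exact ⟨1, rfl, by omega, .inl ⟨rfl, fun j hj ↦ hex ⟨j, hj⟩⟩⟩
  have hpos : 1 ≤ p := by omega
  let g : ℕ → ℕ := fun k ↦ if k = 0 then 3 else if k ≤ p then 2 else if k < m then 1 else 3
  have hg_lt {i j : ℕ} (hlt : i < j) (hij : IsChord G n f i j) : g i = g j := by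
    by_cases hi0 : i = 0
    · subst hi0
      rw [huniq' hij h0m]
      simp [g, show m ≠ 0 by omega, hpm.not_ge]
    have hjm : j ≠ m := by
      rintro rfl
      exact hi0 (huniq' hij.symm h0m.symm)
    have him : i ≠ m := by
      rintro rfl
      have := huniq' hij h0m.symm
      omega
    have h1 : i < m → j < m := fun hi ↦ by
      by_contra hj
      exact hcross (by omega) hi (by omega) h0m hij
    -- A chord leaving `[1, p]` would share an end with the chord from 1 to `p` or cross it; for `p
    -- = 1` there is no chord at 1.
    have h2 : i ≤ p → j ≤ p := fun hi ↦ by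
      by_contra hj
      rcases hp1 with ⟨rfl, hno⟩ | hp1
      · obtain rfl : i = 1 := by omega
        exact hno j hij
      · by_cases hi1 : i = 1
        · subst hi1
          have := huniq' hij hp1
          omega
        by_cases hip : i = p
        · subst hip
          have := huniq' hij hp1.symm
          omega
        exact hcross (i := 1) (by omega) (by omega) (by omega) hp1 hij
    simp only [g]
    split_ifs <;> omega
  have hg {i j : ℕ} (hij : IsChord G n f i j) : g i = g j := by
    rcases (hne hij).lt_or_gt with hlt | hlt
    · exact hg_lt hlt hij
    · exact (hg_lt hlt hij.symm).symm
  let e : ℕ → ℕ := fun k ↦ if k % 2 = 0 then if k ≤ p then 4 else 2 else if k < m then 3 else 1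
  -- Position 0 is excluded from the consecutive case: `e 0 = 4` while `e (n - 1) = 2`, which is
  -- harmless because 0 has a chord.
  have hcond (i : ℕ) (hi : i < n) (q : ℕ) (hq : q < n) (hiq : q + 1 = i ∨ i = 0 ∧ q + 1 = n) :
      e i ≠ e q ∧ (i ≠ 0 → e i = e q + 1 ∨ e q = e i + 1) ∧
      g i ≠ e i ∧ g i ≠ e q ∧ e i ≤ e q + 2 ∧ e q ≤ e i + 2 ∧
        e i ≤ g i + 2 ∧ g i ≤ e i + 2 ∧ e q ≤ g i + 2 ∧ g i ≤ e q + 2 := by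
    simp only [e, g]
    rcases hiq with rfl | ⟨rfl, hqn⟩
    · split_ifs <;> first | contradiction | omega
    · split_ifs <;> omega
  obtain ⟨α, h1, h2, hr⟩ := h.exists_coloring e g huniq' hg (fun i hi q hq hiq ↦ by
    obtain ⟨c1, c2, c3⟩ := hcond i hi q hq hiq
    refine ⟨c1, fun hno ↦ c2 ?_, fun _ ↦ c3⟩
    rintro rfl
    exact hno ⟨m, h0m⟩)
  refine ⟨α, ?_, h1, h2⟩
  rw [hr]
  ext c
  rw [Set.mem_Icc]
  constructor
  · rintro (⟨i, hi, rfl⟩ | ⟨i, j, hij, rfl⟩)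
    · simp only [e]
      split_ifs <;> omega
    · simp only [g]
      split_ifs <;> omega
  · intro hc
    obtain rfl | rfl | rfl | rfl : c = 1 ∨ c = 2 ∨ c = 3 ∨ c = 4 := by omega
    · exact .inl ⟨m, hmn, by simp [e, hm']⟩
    · exact .inl ⟨n - 1, by omega, by simp only [e]; split_ifs <;> omega⟩
    · exact .inl ⟨1, by omega, by simp [e, show 1 < m by omega]⟩
    · exact .inl ⟨0, by omega, by simp [e]⟩

end IsHamiltonianEnum

end SimpleGraph

/-! ### The theorem. -/

open SimpleGraph in
theorem theorem2 {V : Type*} [Fintype V] (G : SimpleGraph V) [DecidableRel G.Adj]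
    (hconn : G.IsKConnected 2) (houter : G.IsOuterplanar) (hdeg : G.maxDegree = 3) :
    G.IsIntervalColorable ∧
      (Even (Fintype.card V) → IsLeast G.intervalColorNumbers 3) ∧
      (Odd (Fintype.card V) → IsLeast G.intervalColorNumbers 4) := by
  classical
  have : Nonempty V := Fintype.card_pos_iff.1 (by have := hconn.1; omega)
  obtain ⟨v, hv⟩ := G.exists_maximal_degree_vertex
  rw [hdeg, ← card_neighborFinset_eq_degree] at hv
  obtain ⟨a, b, c, hab, hac, hbc, habc⟩ := Finset.card_eq_three.1 hv.symm
  have hnb (x : V) : G.Adj v x ↔ x = a ∨ x = b ∨ x = c := by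
    rw [← mem_neighborFinset, habc]
    simp
  have ha : G.Adj v a := (hnb a).2 (by simp)
  have hb : G.Adj v b := (hnb b).2 (by simp)
  have hc : G.Adj v c := (hnb c).2 (by simp)
  obtain ⟨x, t, ht, hall⟩ := hconn.exists_spanning_isCycleList houter ha hb hab
  obtain ⟨n, f, hf⟩ : ∃ n f, G.IsHamiltonianEnum n f := ⟨_, _, ht.isHamiltonianEnum hall⟩
  have hcard := hf.card_eq
  have h3 := hf.three_le
  have huniq {f : ℕ → V} (h : G.IsHamiltonianEnum n f) {i j k : ℕ} :
      IsHamiltonianEnum.IsChord G n f i j → IsHamiltonianEnum.IsChord G n f i k → j = k :=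
    IsHamiltonianEnum.IsChord.unique h hdeg.le
  -- Without chords the vertex of degree 3 would have only its two cycle neighbors.
  have hchord : ∃ i j, IsHamiltonianEnum.IsChord G n f i j := by
    by_contra! hno
    obtain ⟨i, hi, rfl⟩ := hf.surj v
    have key (x : V) (hx : G.Adj (f i) x) : x = f (i + 1) ∨ x = f (i + n - 1) := by
      obtain ⟨j, hj, rfl⟩ := hf.surj x
      by_contra! hne
      have h1 : i + 1 ≠ j := fun hh ↦ hne.1 (by rw [hh])
      have h2 : j + 1 ≠ i := fun hh ↦ hne.2 (by rw [← hf.periodic j]; congr 1; omega)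
      have h3 : ¬(i = 0 ∧ j + 1 = n) := fun hh ↦ hne.2 (by congr 1; omega)
      have h4 : ¬(j = 0 ∧ i + 1 = n) := fun hh ↦ hne.1 (by
        rw [← hf.periodic j]
        congr 1
        omega)
      exact hno i j ⟨hi, hj, hx, h1, h2, h3, h4⟩
    rcases key a ha with rfl | rfl <;> rcases key b hb with rfl | rfl <;>
      rcases key c hc with rfl | rfl <;> simp_all
  have hdeg2 (v : V) : ∃ a b, G.Adj v a ∧ G.Adj v b ∧ a ≠ b := by
    obtain ⟨i, -, rfl⟩ := hf.surj v
    refine ⟨f (i + 1), f (i + n - 1), hf.adj i, ?_, hf.ne' (by omega) (by omega) (by omega)⟩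
    have := (hf.adj (i + n - 1)).symm
    rwa [Nat.sub_add_cancel (by omega), hf.periodic] at this
  have lower (t : ℕ) (ht : t ∈ G.intervalColorNumbers) : 3 ≤ t := by
    obtain ⟨-, α, hα⟩ := ht
    exact hα.three_le ha hb hc hab hac hbc
  have heven (h : Even (Fintype.card V)) : IsLeast G.intervalColorNumbers 3 :=
    ⟨⟨by omega, hf.exists_isIntervalColoring_three (huniq hf) hchord (hcard ▸ h)⟩, lower⟩
  have hodd (h : Odd (Fintype.card V)) : IsLeast G.intervalColorNumbers 4 := by
    refine ⟨⟨by omega, hf.exists_isIntervalColoring_four houter huniq hchord (hcard ▸ h)⟩, ?_⟩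
    intro t ht
    have h3 := lower t ht
    rcases h3.eq_or_lt with rfl | hlt
    · obtain ⟨-, α, hα⟩ := ht
      exact absurd (hα.even_card hdeg2) (Nat.not_even_iff_odd.2 h)
    · exact hlt
  refine ⟨?_, heven, hodd⟩
  rcases Nat.even_or_odd (Fintype.card V) with h | h
  · exact ⟨3, (heven h).1⟩
  · exact ⟨4, (hodd h).1⟩
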